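/- Let $\sigma>0$ and $\varepsilon>0$ be fixed. For $d\ge 1$ and $\theta_0\in\mathbb{R}^d$, let the data be distributed as $x\sim\mathcal N(0,I_d)$, $y=\theta_0^\top x+z$, where $z\sim\mathcal N(0,\sigma^2)$ is independent of $x$. For $\theta\in\mathbb{R}^d$ let $\mathrm{SR}(\theta)=\mathbb E_{(x,y)}\big[(\theta^\top x-y)^2\big]$ be the nominal risk of $f_\theta(x)=\theta^\top x$, and for $\rho\in[0,1)$ let $$\mathrm{PR}(\theta;\rho)=\mathbb E_{(x,y)}\Big[\inf\big\{u\in\mathbb R:\ \mathbb P_{\delta}\big((\theta^\top(x+\delta)-y)^2>u\big)\le\rho\big\}\Big]$$ be its probabilistically robust risk, i.e. the expectation of the $\rho$-essential supremum over $\delta$ of the squared loss, where $\delta$ is uniform on the ball $\{\|\delta\|_2\le\varepsilon\}\subset\mathbb R^d$. By convention $\mathrm{PR}(\theta;1)=\mathbb E_{(x,y)}\mathbb E_\delta\big[(\theta^\top(x+\delta)-y)^2\big]$. All these expectations are finite, and $\min_\theta\mathrm{SR}(\theta)=\mathrm{SR}(\theta_0)=\sigma^2$. Let $\Theta\subset\mathbb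 R^d$ contain $\theta_0$, and let $\theta^\star\in\Theta$ be any minimizer of $\mathrm{PR}(\cdot\,;\rho)$ over $\Theta$. (a) For every $\rho\in(0,1]$ and every $R$ there is a constant $C=C(\rho,\varepsilon,\sigma,R)$ such that, for all $d$, all $\theta_0$ with $\|\theta_0\|_2\le R$, all such $\Theta$ and all such $\theta^\star$, $$\big|\mathrm{PR}(\theta^\star;\rho)-\mathrm{SR}(\theta_0)\big|\le \frac{C}{\sqrt d}.$$ (b) If $\rho=0$, the gap is bounded and does not vanish: for every $R$ there is a constant $C=C(\varepsilon,\sigma,R)$ with $|\mathrm{PR}(\theta^\star;0)-\mathrm{SR}(\theta_0)|\le C$ for all $d$, all $\theta_0$ with $\|\theta_0\|_2\le R$, all $\Theta$ and all $\theta^\star$; and for every $r>0$ there is a constant $c=c(\varepsilon,\sigma,r)>0$ with $\mathrm{PR}(\theta^\star;0)-\mathrm{SR}(\theta_0)\ge c$ for all $d$, all $\theta_0$ with $\|\theta_0\|_2\ge r$, all $\Theta$ and all $\theta^\star$. -/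

import Mathlib

open MeasureTheory ProbabilityTheory

noncomputable section

/-- The space `ℝ^d` with the Euclidean norm. -/
abbrev Euc (d : ℕ) : Type := EuclideanSpace ℝ (Fin d)

/-- The `ρ`-essential supremum of `f` under `μ`, for a tolerance level `0 ≤ ρ < 1`:
the infimum of the set of real `u` such that `f` exceeds `u` with probability at most `ρ`. -/
def rhoEssSup {Ω : Type*} [MeasurableSpace Ω] (μ : Measure Ω) (ρ : ℝ) (f : Ω → ℝ) : ℝ :=
  sInf {u : ℝ | μ (f ⁻¹' Set.Ioi u) ≤ ENNReal.ofReal ρ}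

/-- The squared loss. -/
def sqLoss (prediction y : ℝ) : ℝ := (prediction - y) ^ 2

/-- The linear hypothesis `x ↦ θᵀ x`. -/
def linHyp {d : ℕ} (θ : Euc d) (x : Euc d) : ℝ := inner ℝ θ x

/-- The law of `(x, y)`, where `y = θ₀ᵀ x + z` with independent `x ~ N(0, I_d)` and
`z ~ N(0, σ²)`. -/
def linRegLaw {d : ℕ} (θ₀ : Euc d) (σ : ℝ) : Measure (Euc d × ℝ) :=
  ((stdGaussian (Euc d)).prod (gaussianReal 0 (σ ^ 2).toNNReal)).map
    (fun p => (p.1, inner ℝ θ₀ p.1 + p.2))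

/-- The uniform distribution on the closed Euclidean ball of radius `ε` about the origin. -/
def ballUniform (d : ℕ) (ε : ℝ) : Measure (Euc d) :=
  cond volume (Metric.closedBall (0 : Euc d) ε)

/-- The nominal (clean) risk of a hypothesis `h`. -/
def nominalRisk {d : ℕ} (D : Measure (Euc d × ℝ)) (h : Euc d → ℝ) : ℝ :=
  ∫ p, sqLoss (h p.1) p.2 ∂D

/-- The probabilistically robust loss of `h` at the data point `p = (x, y)`: the `ρ`-essential
supremum over `δ ~ r` of the loss at `(x + δ, y)` if `ρ ≠ 1`; at the end point `ρ = 1` the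
problem is by convention that of minimizing the average loss under `δ ~ r`. -/
def probRobustLoss {d : ℕ} (r : Measure (Euc d)) (ρ : ℝ) (h : Euc d → ℝ) (p : Euc d × ℝ) : ℝ :=
  open Classical in
  if ρ = 1 then ∫ δ, sqLoss (h (p.1 + δ)) p.2 ∂r
  else rhoEssSup r ρ (fun δ => sqLoss (h (p.1 + δ)) p.2)

/-- The probabilistically robust risk of `h` at tolerance level `ρ`. -/
def probRobustRisk {d : ℕ} (D : Measure (Euc d × ℝ)) (r : Measure (Euc d)) (ρ : ℝ)
    (h : Euc d → ℝ) : ℝ :=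
  ∫ p, probRobustLoss r ρ h p ∂D

/-- `θ` is an optimal solution, over the parameter set `Θ`, of the probabilistically robust
linear regression problem with tolerance `ρ`. -/
def IsProbRobustOptimal {d : ℕ} (θ₀ : Euc d) (σ ε ρ : ℝ) (Θ : Set (Euc d)) (θ : Euc d) : Prop :=
  θ ∈ Θ ∧ IsMinOn
    (fun θ' => probRobustRisk (linRegLaw θ₀ σ) (ballUniform d ε) ρ (linHyp θ')) Θ θ

end

/-! Perturbing `x` by `δ` changes the residual `g = θᵀx - y` only by `⟨θ, δ⟩`. By rotation
invariance `⟨θ, δ⟩` has second moment at most `ε²‖θ‖²/d`, so by Chebyshev it is `O(‖θ‖/√d)` outside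
an event of any fixed positive probability (`ballUniform_abs_inner_gt_le`). For `ρ > 0` such an
event may be discarded, and the robust loss equals `g²` up to `O(1/√d)·(g² + ‖θ‖²)`
(`ballLoss_le_of_tail`, `le_ballLoss_of_tail`).

These bounds are quadratic in `g`, so integrating them needs only `E g² = ‖θ - θ₀‖² + σ²`.
Comparison with `θ₀` bounds the optimal risk above; the lower bound absorbs `‖θ‖²` into `‖θ - θ₀‖² +
‖θ₀‖²`.

For `ρ = 0` nothing is discarded: the worst `δ` along `±θ` adds at least `ε²‖θ‖²` to the loss
(`sq_add_le_ballLoss_zero`), and `‖θ - θ₀‖²` and `‖θ‖²` cannot both be small when `‖θ₀‖ ≥ r`. -/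

/-! ### Essential suprema at tolerance `ρ`. -/

section EssSup

variable {Ω : Type*} [MeasurableSpace Ω] {μ : Measure Ω} {ρ : ℝ} {f f' : Ω → ℝ}

theorem nonempty_rhoEssSup_set {B : ℝ} (hB : ∀ᵐ ω ∂μ, f ω ≤ B) :
    {u : ℝ | μ (f ⁻¹' Set.Ioi u) ≤ ENNReal.ofReal ρ}.Nonempty := by
  refine ⟨B, ?_⟩
  have : μ (f ⁻¹' Set.Ioi B) = 0 := by
    rw [← nonpos_iff_eq_zero, ← ae_iff.1 hB]
    exact measure_mono fun ω hω => by simpa using hω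
  simp [this]

/-- If `u < c`, the events `f < c` and `f > u` cover the space, so their masses sum to at least 1.
-/
theorem le_of_measure_lt [IsProbabilityMeasure μ] {c u : ℝ}
    (hc : μ {ω | f ω < c} + ENNReal.ofReal ρ < 1)
    (hu : μ (f ⁻¹' Set.Ioi u) ≤ ENNReal.ofReal ρ) : c ≤ u := by
  by_contra! h
  have h1 : (1 : ENNReal) ≤ μ {ω | f ω < c} + μ (f ⁻¹' Set.Ioi u) := by
    rw [← measure_univ (μ := μ)]
    refine (measure_mono fun ω _ => ?_).trans (measure_union_le _ _)
    rcases le_or_gt (f ω) u with h' | h'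
    · exact Or.inl (h'.trans_lt h)
    · exact Or.inr h'
  exact absurd (h1.trans (by gcongr)) (not_le.2 hc)

theorem le_rhoEssSup [IsProbabilityMeasure μ] {B c : ℝ}
    (hB : ∀ᵐ ω ∂μ, f ω ≤ B) (hc : μ {ω | f ω < c} + ENNReal.ofReal ρ < 1) :
    c ≤ rhoEssSup μ ρ f :=
  le_csInf (nonempty_rhoEssSup_set hB) fun _ hu => le_of_measure_lt hc hu

theorem bddBelow_rhoEssSup_set [IsProbabilityMeasure μ] (h0 : ∀ ω, 0 ≤ f ω)
    (hρ : ρ < 1) : BddBelow {u : ℝ | μ (f ⁻¹' Set.Ioi u) ≤ ENNReal.ofReal ρ} := by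
  refine ⟨0, fun u hu => le_of_measure_lt ?_ hu⟩
  have : {ω | f ω < 0} = ∅ := by ext ω; simpa using h0 ω
  rw [this, measure_empty, zero_add]
  exact ENNReal.ofReal_lt_one.2 hρ

theorem rhoEssSup_le [IsProbabilityMeasure μ] (h0 : ∀ ω, 0 ≤ f ω)
    (hρ : ρ < 1) {u : ℝ} (hu : μ (f ⁻¹' Set.Ioi u) ≤ ENNReal.ofReal ρ) :
    rhoEssSup μ ρ f ≤ u :=
  csInf_le (bddBelow_rhoEssSup_set h0 hρ) hu

theorem rhoEssSup_le_add [IsProbabilityMeasure μ] (h0 : ∀ ω, 0 ≤ f ω)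
    (hρ : ρ < 1) {B c : ℝ} (hB : ∀ᵐ ω ∂μ, f' ω ≤ B) (h : ∀ᵐ ω ∂μ, f ω ≤ f' ω + c) :
    rhoEssSup μ ρ f ≤ rhoEssSup μ ρ f' + c := by
  rw [← sub_le_iff_le_add]
  refine le_csInf (nonempty_rhoEssSup_set hB) fun u hu => ?_
  rw [sub_le_iff_le_add]
  refine rhoEssSup_le h0 hρ (le_trans (measure_mono_ae ?_) hu)
  filter_upwards [h] with ω hω hω'
  have h1 : u + c < f ω := hω'
  show u < f' ω
  linarith

/-- Supplies measurability of the loss in the residual. The modulus comes from factoring `(g + T)² -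
(a + T)²`. -/
theorem continuous_rhoEssSup_sq [IsProbabilityMeasure μ] {T : Ω → ℝ} {b : ℝ}
    (hb : ∀ᵐ ω ∂μ, |T ω| ≤ b) (hρ : ρ < 1) :
    Continuous fun g : ℝ => rhoEssSup μ ρ fun ω => (g + T ω) ^ 2 := by
  have hbound (g : ℝ) : ∀ᵐ ω ∂μ, (g + T ω) ^ 2 ≤ (|g| + b) ^ 2 := by
    filter_upwards [hb] with ω hω
    exact sq_le_sq' (by linarith [neg_abs_le g, neg_abs_le (T ω)])
      (by linarith [le_abs_self g, le_abs_self (T ω)])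
  have key (g a : ℝ) : rhoEssSup μ ρ (fun ω => (g + T ω) ^ 2) ≤
      rhoEssSup μ ρ (fun ω => (a + T ω) ^ 2) + |g - a| * (|g| + |a| + 2 * b) := by
    refine rhoEssSup_le_add (fun ω => sq_nonneg _) hρ (hbound a) ?_
    filter_upwards [hb] with ω hω
    have h1 : |g + a + 2 * T ω| ≤ |g| + |a| + 2 * b := by
      calc |g + a + 2 * T ω| ≤ |g| + |a| + |2 * T ω| := abs_add_three _ _ _
        _ ≤ _ := by rw [abs_mul, abs_two]; linarith
    have h2 : (g - a) * (g + a + 2 * T ω) ≤ |g - a| * (|g| + |a| + 2 * b) :=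
      (le_abs_self _).trans (by rw [abs_mul]; gcongr)
    linarith
  refine continuous_iff_continuousAt.2 fun a => ?_
  refine tendsto_iff_dist_tendsto_zero.2 (squeeze_zero (fun _ => dist_nonneg)
    (g := fun g => |g - a| * (|g| + |a| + 2 * b)) (fun g => ?_) ?_)
  · rw [Real.dist_eq, abs_sub_le_iff]
    have h1 := key g a
    have h2 := key a g
    rw [abs_sub_comm a g, add_comm |a| |g|] at h2
    constructor <;> linarith
  · have : Continuous fun g : ℝ => |g - a| * (|g| + |a| + 2 * b) := by fun_prop
    simpa using this.tendsto a

end EssSup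

/-! ### Concentration of linear forms on the ball. -/

section Ball

variable {d : ℕ} {ε : ℝ}

theorem isProbabilityMeasure_ballUniform (hε : 0 < ε) :
    IsProbabilityMeasure (ballUniform d ε) :=
  cond_isProbabilityMeasure_of_finite (Metric.measure_closedBall_pos _ _ hε).ne'
    measure_closedBall_lt_top.ne

theorem ae_norm_le_ballUniform : ∀ᵐ δ ∂ballUniform d ε, ‖δ‖ ≤ ε := by
  have h := ae_cond_mem (μ := (volume : Measure (Euc d)))
    (Metric.isClosed_closedBall (x := (0 : Euc d)) (ε := ε)).measurableSet
  filter_upwards [h] with δ hδ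
  simpa using hδ

theorem ae_abs_inner_le_ballUniform (θ : Euc d) :
    ∀ᵐ δ ∂ballUniform d ε, |inner ℝ θ δ| ≤ ε * ‖θ‖ := by
  filter_upwards [ae_norm_le_ballUniform] with δ hδ
  calc |inner ℝ θ δ| ≤ ‖θ‖ * ‖δ‖ := abs_real_inner_le_norm _ _
    _ ≤ ε * ‖θ‖ := by rw [mul_comm]; gcongr

theorem measurePreserving_ballUniform (φ : Euc d ≃ₗᵢ[ℝ] Euc d) :
    MeasurePreserving φ (ballUniform d ε) (ballUniform d ε) := by
  have h := φ.measurePreserving.restrict_preimage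
    (Metric.isClosed_closedBall (x := (0 : Euc d)) (ε := ε)).measurableSet
  have h' : φ ⁻¹' Metric.closedBall (0 : Euc d) ε = Metric.closedBall 0 ε := by
    ext x; simp
  rw [h'] at h
  exact h.smul_measure _

theorem integrable_inner_sq_ballUniform (hε : 0 < ε) (θ : Euc d) :
    Integrable (fun δ => (inner ℝ θ δ : ℝ) ^ 2) (ballUniform d ε) := by
  have := isProbabilityMeasure_ballUniform (d := d) hε
  refine Integrable.of_bound (by fun_prop) ((ε * ‖θ‖) ^ 2) ?_
  filter_upwards [ae_abs_inner_le_ballUniform θ] with δ hδ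
  rw [Real.norm_eq_abs, abs_pow]
  gcongr

theorem integrable_inner_ballUniform (hε : 0 < ε) (θ : Euc d) :
    Integrable (fun δ => (inner ℝ θ δ : ℝ)) (ballUniform d ε) := by
  have := isProbabilityMeasure_ballUniform (d := d) hε
  exact Integrable.of_bound (by fun_prop) (ε * ‖θ‖) (ae_abs_inner_le_ballUniform θ)

theorem integral_inner_ballUniform (θ : Euc d) :
    ∫ δ, (inner ℝ θ δ : ℝ) ∂ballUniform d ε = 0 := by
  have h := (measurePreserving_ballUniform (ε := ε) (LinearIsometryEquiv.neg ℝ (E := Euc d))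
    ).integral_comp' (f := (LinearIsometryEquiv.neg ℝ (E := Euc d)).toMeasurableEquiv)
    (fun δ => (inner ℝ θ δ : ℝ))
  have h' : ∫ δ, (inner ℝ θ (-δ) : ℝ) ∂ballUniform d ε = ∫ δ, (inner ℝ θ δ : ℝ) ∂ballUniform d ε :=
    h
  simp only [inner_neg_right, integral_neg] at h'
  linarith

/-- The reflection exchanging `θ` and `θ'` preserves the uniform law. -/
theorem integral_inner_sq_ballUniform_congr {θ θ' : Euc d} (h : ‖θ‖ = ‖θ'‖) :
    ∫ δ, (inner ℝ θ δ : ℝ) ^ 2 ∂ballUniform d ε = ∫ δ, (inner ℝ θ' δ : ℝ) ^ 2 ∂ballUniform d ε := by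
  set φ := Submodule.reflection (ℝ ∙ (θ - θ'))ᗮ
  have hφ : φ θ = θ' := Submodule.reflection_sub h
  have h1 := (measurePreserving_ballUniform (ε := ε) φ).integral_comp'
    (f := φ.toMeasurableEquiv) (fun δ => (inner ℝ θ' δ : ℝ) ^ 2)
  rw [← h1]
  congr 1 with δ
  show _ = (inner ℝ θ' (φ δ) : ℝ) ^ 2
  rw [← hφ, LinearIsometryEquiv.inner_map_map]

/-- All directions of equal norm share one second moment; summing over the `d` coordinate axes gives
`‖θ‖² E‖δ‖²`. -/
theorem integral_inner_sq_ballUniform_le (hd : 0 < d) (hε : 0 < ε) (θ : Euc d) :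
    ∫ δ, (inner ℝ θ δ : ℝ) ^ 2 ∂ballUniform d ε ≤ ε ^ 2 * ‖θ‖ ^ 2 / d := by
  have := isProbabilityMeasure_ballUniform (d := d) hε
  have hd' : (0 : ℝ) < d := by exact_mod_cast hd
  have h1 (i : Fin d) : ∫ δ, (inner ℝ θ δ : ℝ) ^ 2 ∂ballUniform d ε =
      ∫ δ, (inner ℝ (EuclideanSpace.single i ‖θ‖) δ : ℝ) ^ 2 ∂ballUniform d ε :=
    integral_inner_sq_ballUniform_congr (by simp)
  have h2 : d * ∫ δ, (inner ℝ θ δ : ℝ) ^ 2 ∂ballUniform d ε =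
      ∫ δ, ‖θ‖ ^ 2 * ‖δ‖ ^ 2 ∂ballUniform d ε := by
    calc d * ∫ δ, (inner ℝ θ δ : ℝ) ^ 2 ∂ballUniform d ε
        = ∑ _i : Fin d, ∫ δ, (inner ℝ θ δ : ℝ) ^ 2 ∂ballUniform d ε := by simp
      _ = ∑ i : Fin d,
          ∫ δ, (inner ℝ (EuclideanSpace.single i ‖θ‖) δ : ℝ) ^ 2 ∂ballUniform d ε :=
        Finset.sum_congr rfl fun i _ => h1 i
      _ = ∫ δ, ∑ i : Fin d, (inner ℝ (EuclideanSpace.single i ‖θ‖) δ : ℝ) ^ 2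
            ∂ballUniform d ε :=
        (integral_finsetSum _ fun i _ => integrable_inner_sq_ballUniform hε _).symm
      _ = _ := by
        congr 1 with δ
        simp [EuclideanSpace.inner_single_left, mul_pow, ← Finset.mul_sum,
          EuclideanSpace.real_norm_sq_eq]
  have h3 : ∫ δ, ‖θ‖ ^ 2 * ‖δ‖ ^ 2 ∂ballUniform d ε ≤ ∫ _δ, ‖θ‖ ^ 2 * ε ^ 2 ∂ballUniform d ε := by
    refine integral_mono_of_nonneg (Filter.Eventually.of_forall fun δ => by positivity)
      (integrable_const _) ?_
    filter_upwards [ae_norm_le_ballUniform] with δ hδ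
    gcongr
  rw [le_div_iff₀ hd']
  simp only [integral_const, probReal_univ, one_smul] at h3
  linarith

theorem ballUniform_abs_inner_gt_le (hd : 0 < d) (hε : 0 < ε) (θ : Euc d) {κ : ℝ} (hκ : 0 < κ) :
    ballUniform d ε {δ | κ * ε / √d * ‖θ‖ < |inner ℝ θ δ|} ≤ ENNReal.ofReal (1 / κ ^ 2) := by
  have := isProbabilityMeasure_ballUniform (d := d) hε
  have hd' : (0 : ℝ) < d := by exact_mod_cast hd
  rcases eq_or_ne θ 0 with rfl | hθ
  · simp
  have hθ' : 0 < ‖θ‖ := norm_pos_iff.2 hθ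
  set t := κ * ε / √d * ‖θ‖ with ht
  have htpos : 0 < t := by positivity
  have htsq : t ^ 2 = κ ^ 2 * (ε ^ 2 * ‖θ‖ ^ 2 / d) := by
    rw [ht, mul_pow, div_pow, Real.sq_sqrt hd'.le]; ring
  have h1 := mul_meas_ge_le_integral_of_nonneg (μ := ballUniform d ε)
    (Filter.Eventually.of_forall fun δ => sq_nonneg (inner ℝ θ δ : ℝ))
    (integrable_inner_sq_ballUniform hε θ) (t ^ 2)
  have h2 := h1.trans (integral_inner_sq_ballUniform_le hd hε θ)
  rw [← ENNReal.ofReal_toReal (measure_ne_top (ballUniform d ε) {δ | t < |inner ℝ θ δ|})]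
  refine ENNReal.ofReal_le_ofReal ?_
  have h3 : (ballUniform d ε).real {δ | t < |inner ℝ θ δ|} ≤
      (ballUniform d ε).real {δ | t ^ 2 ≤ (inner ℝ θ δ : ℝ) ^ 2} := by
    refine measureReal_mono fun δ hδ => ?_
    show t ^ 2 ≤ _
    rw [← sq_abs (inner ℝ θ δ)]
    exact pow_le_pow_left₀ htpos.le (le_of_lt hδ) 2
  refine h3.trans ?_
  rw [htsq] at h2 h3 ⊢
  rw [le_div_iff₀ (by positivity)]
  have hp : 0 < ε ^ 2 * ‖θ‖ ^ 2 / d := by positivity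
  refine le_of_mul_le_mul_right ?_ hp
  linarith

end Ball

/-! ### Pointwise bounds on the loss in terms of the residual. -/

noncomputable section

/-- The probabilistically robust loss of the linear hypothesis `θ` under uniform perturbations
of the ball of radius `ε`, as a function of the residual `g = θᵀ x - y`. -/
def ballLoss {d : ℕ} (ε ρ : ℝ) (θ : Euc d) (g : ℝ) : ℝ :=
  open Classical in
  if ρ = 1 then ∫ δ, (g + inner ℝ θ δ) ^ 2 ∂ballUniform d ε
  else rhoEssSup (ballUniform d ε) ρ fun δ => (g + inner ℝ θ δ) ^ 2

end

section BallLoss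

variable {d : ℕ} {ε ρ : ℝ}

theorem probRobustLoss_linHyp (θ : Euc d) (p : Euc d × ℝ) :
    probRobustLoss (ballUniform d ε) ρ (linHyp θ) p = ballLoss ε ρ θ (inner ℝ θ p.1 - p.2) := by
  have h (δ : Euc d) : sqLoss (linHyp θ (p.1 + δ)) p.2 =
      (inner ℝ θ p.1 - p.2 + inner ℝ θ δ) ^ 2 := by
    simp only [sqLoss, linHyp, inner_add_right]; ring
  simp only [probRobustLoss, ballLoss, h]

theorem ballLoss_one (hε : 0 < ε) (θ : Euc d) (g : ℝ) :
    ballLoss ε 1 θ g = g ^ 2 + ∫ δ, (inner ℝ θ δ : ℝ) ^ 2 ∂ballUniform d ε := by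
  have := isProbabilityMeasure_ballUniform (d := d) hε
  have h (δ : Euc d) : (g + inner ℝ θ δ : ℝ) ^ 2 =
      (g ^ 2 + 2 * g * inner ℝ θ δ) + (inner ℝ θ δ) ^ 2 := by ring
  have h1 : Integrable (fun δ : Euc d => 2 * g * (inner ℝ θ δ : ℝ)) (ballUniform d ε) :=
    (integrable_inner_ballUniform hε θ).const_mul _
  simp only [ballLoss, if_true, h]
  have h2 : Integrable (fun δ : Euc d => g ^ 2 + 2 * g * (inner ℝ θ δ : ℝ)) (ballUniform d ε) :=
    (integrable_const _).add h1
  rw [integral_add h2 (integrable_inner_sq_ballUniform hε θ),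
    integral_add (integrable_const _) h1, integral_const_mul, integral_inner_ballUniform]
  simp

theorem continuous_ballLoss (hε : 0 < ε) (hρ : ρ ≤ 1) (θ : Euc d) :
    Continuous (ballLoss ε ρ θ) := by
  have := isProbabilityMeasure_ballUniform (d := d) hε
  rcases eq_or_ne ρ 1 with rfl | h
  · rw [show ballLoss ε 1 θ = _ from funext (ballLoss_one hε θ)]
    fun_prop
  · have h' : ballLoss ε ρ θ =
        fun g => rhoEssSup (ballUniform d ε) ρ fun δ => (g + inner ℝ θ δ) ^ 2 := by
      funext g; simp [ballLoss, h]
    rw [h']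
    exact continuous_rhoEssSup_sq (ae_abs_inner_le_ballUniform θ) (lt_of_le_of_ne hρ h)

theorem ae_sq_add_inner_le_ballUniform (θ : Euc d) (g : ℝ) :
    ∀ᵐ δ ∂ballUniform d ε, (g + inner ℝ θ δ : ℝ) ^ 2 ≤ (|g| + ε * ‖θ‖) ^ 2 := by
  filter_upwards [ae_abs_inner_le_ballUniform θ] with δ hδ
  rw [← sq_abs (g + _)]
  have := abs_add_le g (inner ℝ θ δ)
  gcongr
  linarith

theorem ballLoss_nonneg (hε : 0 < ε) (hρ : ρ ≤ 1) (θ : Euc d) (g : ℝ) : 0 ≤ ballLoss ε ρ θ g := by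
  have := isProbabilityMeasure_ballUniform (d := d) hε
  rcases eq_or_ne ρ 1 with rfl | h
  · rw [ballLoss_one hε]
    exact add_nonneg (sq_nonneg _) (integral_nonneg fun _ => sq_nonneg _)
  · simp only [ballLoss, h, if_false]
    refine le_rhoEssSup (ae_sq_add_inner_le_ballUniform θ g) ?_
    have : {δ : Euc d | (g + inner ℝ θ δ : ℝ) ^ 2 < 0} = ∅ := by
      ext δ; simpa using sq_nonneg _
    rw [this, measure_empty, zero_add]
    exact ENNReal.ofReal_lt_one.2 (lt_of_le_of_ne hρ h)

theorem ballLoss_le (hε : 0 < ε) (hρ : ρ ≤ 1) (θ : Euc d) (g : ℝ) :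
    ballLoss ε ρ θ g ≤ (|g| + ε * ‖θ‖) ^ 2 := by
  have := isProbabilityMeasure_ballUniform (d := d) hε
  have hae := ae_sq_add_inner_le_ballUniform (ε := ε) θ g
  rcases eq_or_ne ρ 1 with rfl | h
  · have h1 := integral_mono_of_nonneg (Filter.Eventually.of_forall fun δ => sq_nonneg _)
      (integrable_const _) hae
    simpa [ballLoss] using h1
  · simp only [ballLoss, h, if_false]
    refine rhoEssSup_le (fun _ => sq_nonneg _) (lt_of_le_of_ne hρ h) ?_
    have : ballUniform d ε ((fun δ => (g + inner ℝ θ δ : ℝ) ^ 2) ⁻¹'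
        Set.Ioi ((|g| + ε * ‖θ‖) ^ 2)) = 0 := by
      rw [← nonpos_iff_eq_zero, ← ae_iff.1 hae]
      exact measure_mono fun δ hδ => by simpa using hδ
    simp [this]

/-- Continuity turns the essential bound into one on the whole closed ball; averaging it over `δ =
±εθ/‖θ‖` cancels the cross term. -/
theorem sq_add_le_ballLoss_zero (hε : 0 < ε) (θ : Euc d) (g : ℝ) :
    g ^ 2 + ε ^ 2 * ‖θ‖ ^ 2 ≤ ballLoss ε 0 θ g := by
  have := isProbabilityMeasure_ballUniform (d := d) hε
  have h01 : (0 : ℝ) ≠ 1 := zero_ne_one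
  simp only [ballLoss, h01, if_false]
  refine le_csInf (nonempty_rhoEssSup_set (ae_sq_add_inner_le_ballUniform θ g)) fun u hu => ?_
  have hcont : Continuous fun δ : Euc d => (g + inner ℝ θ δ : ℝ) ^ 2 := by fun_prop
  set A := (fun δ : Euc d => (g + inner ℝ θ δ : ℝ) ^ 2) ⁻¹' Set.Ioi u with hA
  have hAo : IsOpen A := isOpen_Ioi.preimage hcont
  have h0 : ballUniform d ε A = 0 := by simpa using hu
  rw [ballUniform, cond_apply Metric.isClosed_closedBall.measurableSet, mul_eq_zero,
    ENNReal.inv_eq_zero] at h0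
  have h1 : volume (Metric.closedBall (0 : Euc d) ε ∩ A) = 0 :=
    h0.resolve_left measure_closedBall_lt_top.ne
  have h2 : Metric.ball (0 : Euc d) ε ∩ A = ∅ :=
    (Metric.isOpen_ball.inter hAo).measure_eq_zero_iff volume |>.1
      (measure_mono_null (Set.inter_subset_inter_left _ Metric.ball_subset_closedBall) h1)
  -- A null open set misses the open ball, which is dense in the closed one.
  have h3 : Metric.closedBall (0 : Euc d) ε ⊆ Aᶜ := by
    rw [← closure_ball _ hε.ne']
    refine closure_minimal (fun x hx hxA => ?_) hAo.isClosed_compl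
    exact (h2.subset ⟨hx, hxA⟩ : x ∈ (∅ : Set _))
  have h4 (δ : Euc d) (hδ : ‖δ‖ ≤ ε) : (g + inner ℝ θ δ : ℝ) ^ 2 ≤ u := by
    have := h3 (mem_closedBall_zero_iff.2 hδ)
    simpa [hA] using this
  have hin : (inner ℝ θ ((ε / ‖θ‖) • θ) : ℝ) = ε * ‖θ‖ := by
    rw [inner_smul_right, real_inner_self_eq_norm_sq]
    rcases eq_or_ne ‖θ‖ 0 with h | h
    · simp [h]
    · field_simp
  have hn : ‖(ε / ‖θ‖) • θ‖ ≤ ε := by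
    rw [norm_smul, norm_div, norm_norm, Real.norm_of_nonneg hε.le]
    rcases eq_or_ne ‖θ‖ 0 with h | h
    · simp [h, hε.le]
    · rw [div_mul_cancel₀ _ h]
  have h5 := h4 _ hn
  have h6 := h4 (-((ε / ‖θ‖) • θ)) (by rwa [norm_neg])
  rw [inner_neg_right, hin] at h6
  rw [hin] at h5
  linarith

theorem two_mul_abs_mul_le (a η b : ℝ) (hη : 0 ≤ η) :
    2 * |a| * (η * b) ≤ η * a ^ 2 + η * b ^ 2 := by
  have h := mul_nonneg hη (sq_nonneg (|a| - b))
  have h' := sq_abs a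
  rw [← h']
  linarith

/-- The choice `κ = 1/√ρ` makes the Chebyshev tail exactly `ρ`. -/
theorem ballLoss_le_of_tail (hd : 0 < d) (hε : 0 < ε) (h0 : 0 < ρ) (hρ : ρ ≤ 1) {K : ℝ}
    (hK : ε / √ρ ≤ K) (θ : Euc d) (g : ℝ) :
    ballLoss ε ρ θ g ≤ g ^ 2 + K / √d * (g ^ 2 + ‖θ‖ ^ 2) + (K / √d) ^ 2 * ‖θ‖ ^ 2 := by
  have := isProbabilityMeasure_ballUniform (d := d) hε
  have hd' : (0 : ℝ) < d := by exact_mod_cast hd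
  have hK0 : 0 < K := lt_of_lt_of_le (by positivity) hK
  rcases eq_or_ne ρ 1 with rfl | h
  · rw [ballLoss_one hε]
    have h1 := integral_inner_sq_ballUniform_le hd hε θ
    have h2 : ε ^ 2 * ‖θ‖ ^ 2 / d ≤ (K / √d) ^ 2 * ‖θ‖ ^ 2 := by
      rw [div_pow, Real.sq_sqrt hd'.le, div_mul_eq_mul_div]
      have : ε ≤ K := by simpa using hK
      gcongr
    have h3 : 0 ≤ K / √d * (g ^ 2 + ‖θ‖ ^ 2) := by positivity
    linarith
  · simp only [ballLoss, h, if_false]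
    have hle : (|g| + K / √d * ‖θ‖) ^ 2 ≤
        g ^ 2 + K / √d * (g ^ 2 + ‖θ‖ ^ 2) + (K / √d) ^ 2 * ‖θ‖ ^ 2 := by
      have h1 := two_mul_abs_mul_le g (K / √d) ‖θ‖ (by positivity)
      have h2 := sq_abs g
      linarith
    refine le_trans ?_ hle
    refine rhoEssSup_le (fun _ => sq_nonneg _) (lt_of_le_of_ne hρ h) ?_
    have htail := ballUniform_abs_inner_gt_le hd hε θ (κ := 1 / √ρ) (by positivity)
    rw [div_pow, Real.sq_sqrt h0.le, one_pow, one_div_one_div] at htail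
    refine (measure_mono fun δ hδ => ?_).trans htail
    have hδ' : (|g| + K / √d * ‖θ‖) ^ 2 < (g + inner ℝ θ δ : ℝ) ^ 2 := hδ
    have h1 := abs_lt_of_sq_lt_sq (by rwa [sq_abs] : (|g| + K / √d * ‖θ‖) ^ 2 <
      |(g + inner ℝ θ δ : ℝ)| ^ 2) (abs_nonneg _)
    rw [abs_of_nonneg (by positivity)] at h1
    have h2 := abs_add_le g (inner ℝ θ δ)
    have h3 : 1 / √ρ * ε / √d * ‖θ‖ ≤ K / √d * ‖θ‖ := by
      have : 1 / √ρ * ε ≤ K := by rw [one_div_mul_eq_div]; exact hK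
      gcongr
    show 1 / √ρ * ε / √d * ‖θ‖ < _
    linarith

/-- With `κ = 2/√(1 - ρ)` the tail is `(1 - ρ)/4`, which added to `ρ` stays strictly below 1. -/
theorem le_ballLoss_of_tail (hd : 0 < d) (hε : 0 < ε) (h0 : 0 ≤ ρ) (hρ : ρ ≤ 1) {K : ℝ}
    (hK0 : 0 ≤ K) (hK : 2 * ε / √(1 - ρ) ≤ K) (θ : Euc d) (g : ℝ) :
    g ^ 2 - K / √d * (g ^ 2 + ‖θ‖ ^ 2) ≤ ballLoss ε ρ θ g := by
  have := isProbabilityMeasure_ballUniform (d := d) hε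
  rcases eq_or_ne ρ 1 with rfl | h
  · rw [ballLoss_one hε]
    have h1 : 0 ≤ K / √d * (g ^ 2 + ‖θ‖ ^ 2) := by positivity
    have h2 : 0 ≤ ∫ δ, (inner ℝ θ δ : ℝ) ^ 2 ∂ballUniform d ε :=
      integral_nonneg fun _ => sq_nonneg _
    linarith
  · have hρ' : 0 < 1 - ρ := sub_pos.2 (lt_of_le_of_ne hρ h)
    simp only [ballLoss, h, if_false]
    refine le_rhoEssSup (ae_sq_add_inner_le_ballUniform θ g) ?_
    have htail := ballUniform_abs_inner_gt_le hd hε θ (κ := 2 / √(1 - ρ)) (by positivity)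
    rw [div_pow, Real.sq_sqrt hρ'.le, one_div_div] at htail
    have hsub : {δ : Euc d | (g + inner ℝ θ δ : ℝ) ^ 2 < g ^ 2 - K / √d * (g ^ 2 + ‖θ‖ ^ 2)} ⊆
        {δ | 2 / √(1 - ρ) * ε / √d * ‖θ‖ < |inner ℝ θ δ|} := by
      intro δ hδ
      have hδ' : (g + inner ℝ θ δ : ℝ) ^ 2 < g ^ 2 - K / √d * (g ^ 2 + ‖θ‖ ^ 2) := hδ
      show _ < |(inner ℝ θ δ : ℝ)|
      by_contra! hcon
      have h3 : 2 / √(1 - ρ) * ε / √d * ‖θ‖ ≤ K / √d * ‖θ‖ := by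
        have : 2 / √(1 - ρ) * ε ≤ K := by rw [div_mul_eq_mul_div]; exact hK
        gcongr
      have h4 : -(2 * g * inner ℝ θ δ) ≤ 2 * |g| * (K / √d * ‖θ‖) := by
        refine (neg_le_abs (2 * g * inner ℝ θ δ : ℝ)).trans ?_
        rw [abs_mul, abs_mul, abs_two]
        gcongr
        exact hcon.trans h3
      have h5 := two_mul_abs_mul_le g (K / √d) ‖θ‖ (by positivity)
      have h6 := sq_nonneg (inner ℝ θ δ : ℝ)
      linarith
    calc _ ≤ ENNReal.ofReal ((1 - ρ) / 2 ^ 2) + ENNReal.ofReal ρ := by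
          gcongr
          exact (measure_mono hsub).trans htail
      _ = ENNReal.ofReal ((1 - ρ) / 2 ^ 2 + ρ) := (ENNReal.ofReal_add (by positivity) h0).symm
      _ < 1 := ENNReal.ofReal_lt_one.2 (by linarith)

end BallLoss

/-! ### Gaussian moments and the passage from loss to risk. -/

section Risk

variable {d : ℕ} {θ₀ : Euc d} {σ : ℝ}

instance isProbabilityMeasure_linRegLaw (θ₀ : Euc d) (σ : ℝ) :
    IsProbabilityMeasure (linRegLaw θ₀ σ) :=
  Measure.isProbabilityMeasure_map (by fun_prop)

theorem memLp_inner_stdGaussian (v : Euc d) :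
    MemLp (fun x => (inner ℝ v x : ℝ)) 2 (stdGaussian (Euc d)) :=
  (IsGaussian.memLp_two_id (μ := stdGaussian (Euc d))).continuousLinearMap_comp (innerSL ℝ v)

theorem memLp_inner_sub_snd_prod (v : Euc d) (s : NNReal) :
    MemLp (fun p : Euc d × ℝ => (inner ℝ v p.1 - p.2 : ℝ)) 2
      ((stdGaussian (Euc d)).prod (gaussianReal 0 s)) :=
  ((memLp_inner_stdGaussian v).comp_fst _).sub
    ((memLp_id_gaussianReal' 2 ENNReal.ofNat_ne_top).comp_snd _)

theorem integral_inner_sub_snd_sq_prod (v : Euc d) (s : NNReal) :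
    ∫ p : Euc d × ℝ, (inner ℝ v p.1 - p.2 : ℝ) ^ 2 ∂(stdGaussian (Euc d)).prod (gaussianReal 0 s) =
      ‖v‖ ^ 2 + s := by
  have hX := memLp_inner_stdGaussian v
  have hY : MemLp (fun z : ℝ => -z) 2 (gaussianReal 0 s) :=
    (memLp_id_gaussianReal' 2 ENNReal.ofNat_ne_top).neg
  have hvar := variance_add_prod hX hY
  have hXv : Var[fun x => (inner ℝ v x : ℝ); stdGaussian (Euc d)] = ‖v‖ ^ 2 := by
    have h := variance_dual_stdGaussian (innerSL ℝ v)
    rwa [innerSL_apply_norm] at h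
  have hYv : Var[fun z : ℝ => -z; gaussianReal 0 s] = s := by
    rw [variance_fun_neg]
    exact variance_id_gaussianReal
  have hX0 : ∫ x, (inner ℝ v x : ℝ) ∂stdGaussian (Euc d) = 0 :=
    integral_strongDual_stdGaussian (innerSL ℝ v)
  have hY0 : ∫ z : ℝ, z ∂gaussianReal 0 s = 0 := integral_id_gaussianReal
  have hmean : ∫ p : Euc d × ℝ, ((inner ℝ v p.1 : ℝ) + -p.2)
      ∂(stdGaussian (Euc d)).prod (gaussianReal 0 s) = 0 := by
    rw [integral_add ((hX.integrable one_le_two).comp_fst _) ((hY.integrable one_le_two).comp_snd _),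
      integral_fun_fst (fun x => (inner ℝ v x : ℝ)), integral_fun_snd (fun z : ℝ => -z),
      integral_neg, hX0, hY0]
    simp
  rw [hXv, hYv, variance_of_integral_eq_zero (by fun_prop) hmean] at hvar
  simpa only [sub_eq_add_neg] using hvar

theorem memLp_residual (θ₀ θ : Euc d) (σ : ℝ) :
    MemLp (fun p : Euc d × ℝ => (inner ℝ θ p.1 - p.2 : ℝ)) 2 (linRegLaw θ₀ σ) := by
  refine (memLp_map_measure_iff (by fun_prop) (by fun_prop)).2 ?_
  refine (memLp_inner_sub_snd_prod (θ - θ₀) (σ ^ 2).toNNReal).congr_norm (by fun_prop)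
    (Filter.Eventually.of_forall fun p => ?_)
  simp only [Function.comp_apply, inner_sub_left, sub_sub]

theorem integral_residual_sq (θ₀ θ : Euc d) (σ : ℝ) :
    ∫ p, (inner ℝ θ p.1 - p.2 : ℝ) ^ 2 ∂linRegLaw θ₀ σ = ‖θ - θ₀‖ ^ 2 + σ ^ 2 := by
  rw [linRegLaw, integral_map (by fun_prop) (by fun_prop)]
  have h := integral_inner_sub_snd_sq_prod (θ - θ₀) (σ ^ 2).toNNReal
  rw [Real.coe_toNNReal _ (sq_nonneg σ)] at h
  rw [← h]
  congr 1 with p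
  simp only [inner_sub_left, sub_sub]

theorem integrable_residual_sq (θ₀ θ : Euc d) (σ : ℝ) :
    Integrable (fun p : Euc d × ℝ => (inner ℝ θ p.1 - p.2 : ℝ) ^ 2) (linRegLaw θ₀ σ) :=
  (memLp_residual θ₀ θ σ).integrable_sq

theorem nominalRisk_linHyp (θ₀ θ : Euc d) (σ : ℝ) :
    nominalRisk (linRegLaw θ₀ σ) (linHyp θ) = ‖θ - θ₀‖ ^ 2 + σ ^ 2 :=
  integral_residual_sq θ₀ θ σ

theorem probRobustRisk_linHyp (θ₀ θ : Euc d) (σ ε ρ : ℝ) :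
    probRobustRisk (linRegLaw θ₀ σ) (ballUniform d ε) ρ (linHyp θ) =
      ∫ p, ballLoss ε ρ θ (inner ℝ θ p.1 - p.2) ∂linRegLaw θ₀ σ := by
  simp only [probRobustRisk, probRobustLoss_linHyp]

variable {ε ρ : ℝ}

theorem integrable_ballLoss (hε : 0 < ε) (hρ : ρ ≤ 1) (θ₀ θ : Euc d) (σ : ℝ) :
    Integrable (fun p : Euc d × ℝ => ballLoss ε ρ θ (inner ℝ θ p.1 - p.2)) (linRegLaw θ₀ σ) := by
  have hb : Integrable (fun p : Euc d × ℝ => (|(inner ℝ θ p.1 - p.2 : ℝ)| + ε * ‖θ‖) ^ 2)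
      (linRegLaw θ₀ σ) :=
    ((memLp_residual θ₀ θ σ).abs.add (memLp_const (ε * ‖θ‖))).integrable_sq
  refine hb.mono' ((continuous_ballLoss hε hρ θ).comp (by fun_prop)).aestronglyMeasurable
    (Filter.Eventually.of_forall fun p => ?_)
  rw [Real.norm_of_nonneg (ballLoss_nonneg hε hρ θ _)]
  exact ballLoss_le hε hρ θ _

theorem probRobustRisk_nonneg (hε : 0 < ε) (hρ : ρ ≤ 1) (θ₀ θ : Euc d) (σ : ℝ) :
    0 ≤ probRobustRisk (linRegLaw θ₀ σ) (ballUniform d ε) ρ (linHyp θ) := by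
  rw [probRobustRisk_linHyp]
  exact integral_nonneg fun p => ballLoss_nonneg hε hρ θ _

/-- A quadratic lower bound on the loss as a function of the residual passes to the risk. -/
theorem le_probRobustRisk (hε : 0 < ε) (hρ : ρ ≤ 1) (θ₀ θ : Euc d) (σ : ℝ) {A B : ℝ}
    (h : ∀ g, A * g ^ 2 + B ≤ ballLoss ε ρ θ g) :
    A * (‖θ - θ₀‖ ^ 2 + σ ^ 2) + B ≤
      probRobustRisk (linRegLaw θ₀ σ) (ballUniform d ε) ρ (linHyp θ) := by
  have hi := (integrable_residual_sq θ₀ θ σ).const_mul A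
  rw [probRobustRisk_linHyp]
  refine le_trans (le_of_eq ?_) (integral_mono (hi.add (integrable_const B))
    (integrable_ballLoss hε hρ θ₀ θ σ) fun p => h (inner ℝ θ p.1 - p.2))
  simp only [Pi.add_apply]
  rw [integral_add hi (integrable_const B), integral_const_mul, integral_residual_sq]
  simp

/-- A quadratic upper bound on the loss as a function of the residual passes to the risk. -/
theorem probRobustRisk_le (hε : 0 < ε) (hρ : ρ ≤ 1) (θ₀ θ : Euc d) (σ : ℝ) {A B : ℝ}
    (h : ∀ g, ballLoss ε ρ θ g ≤ A * g ^ 2 + B) :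
    probRobustRisk (linRegLaw θ₀ σ) (ballUniform d ε) ρ (linHyp θ) ≤
      A * (‖θ - θ₀‖ ^ 2 + σ ^ 2) + B := by
  have hi := (integrable_residual_sq θ₀ θ σ).const_mul A
  rw [probRobustRisk_linHyp]
  refine le_trans (integral_mono (integrable_ballLoss hε hρ θ₀ θ σ)
    (hi.add (integrable_const B)) fun p => h (inner ℝ θ p.1 - p.2)) (le_of_eq ?_)
  simp only [Pi.add_apply]
  rw [integral_add hi (integrable_const B), integral_const_mul, integral_residual_sq]
  simp

theorem le_probRobustRisk_zero (hε : 0 < ε) (θ₀ θ : Euc d) (σ : ℝ) :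
    ‖θ - θ₀‖ ^ 2 + σ ^ 2 + ε ^ 2 * ‖θ‖ ^ 2 ≤
      probRobustRisk (linRegLaw θ₀ σ) (ballUniform d ε) 0 (linHyp θ) := by
  have h := le_probRobustRisk hε zero_le_one θ₀ θ σ (A := 1) (B := ε ^ 2 * ‖θ‖ ^ 2)
    fun g => by rw [one_mul]; exact sq_add_le_ballLoss_zero hε θ g
  rwa [one_mul] at h

theorem abs_probRobustRisk_sub_le (hd : 0 < d) (hε : 0 < ε) (h0 : 0 < ρ) (hρ : ρ ≤ 1) {K R : ℝ}
    (hK : ε / √ρ ≤ K) (hK' : 2 * ε / √(1 - ρ) ≤ K) {θ₀ : Euc d} {Θ : Set (Euc d)} {θ : Euc d}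
    (hR : ‖θ₀‖ ≤ R) (hmem : θ₀ ∈ Θ) (hopt : IsProbRobustOptimal θ₀ σ ε ρ Θ θ) :
    |probRobustRisk (linRegLaw θ₀ σ) (ballUniform d ε) ρ (linHyp θ) - σ ^ 2| ≤
      K * (3 * σ ^ 2 + 2 * R ^ 2 + K * R ^ 2) / √d := by
  have hK0 : 0 < K := lt_of_lt_of_le (by positivity) hK
  have hd1 : 1 ≤ √(d : ℝ) := Real.one_le_sqrt.2 (by exact_mod_cast hd)
  set η := K / √d with hη
  have hη0 : 0 ≤ η := by positivity
  have hηK : η ≤ K := div_le_self hK0.le hd1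
  have hR2 : ‖θ₀‖ ^ 2 ≤ R ^ 2 := by gcongr
  have hup : probRobustRisk (linRegLaw θ₀ σ) (ballUniform d ε) ρ (linHyp θ₀) ≤
      (1 + η) * (‖θ₀ - θ₀‖ ^ 2 + σ ^ 2) + (η + η ^ 2) * ‖θ₀‖ ^ 2 :=
    probRobustRisk_le hε hρ θ₀ θ₀ σ fun g =>
      (ballLoss_le_of_tail hd hε h0 hρ hK θ₀ g).trans_eq (by ring)
  have hlow : (1 - η) * (‖θ - θ₀‖ ^ 2 + σ ^ 2) + -(η * ‖θ‖ ^ 2) ≤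
      probRobustRisk (linRegLaw θ₀ σ) (ballUniform d ε) ρ (linHyp θ) :=
    le_probRobustRisk hε hρ θ₀ θ σ fun g =>
      (le_ballLoss_of_tail hd hε h0.le hρ hK0.le hK' θ g).trans' (le_of_eq (by ring))
  have hle : probRobustRisk (linRegLaw θ₀ σ) (ballUniform d ε) ρ (linHyp θ) ≤
    probRobustRisk (linRegLaw θ₀ σ) (ballUniform d ε) ρ (linHyp θ₀) := hopt.2 hmem
  have hnn := probRobustRisk_nonneg hε hρ θ₀ θ σ
  rw [sub_self, norm_zero] at hup
  have hC : K * (3 * σ ^ 2 + 2 * R ^ 2 + K * R ^ 2) / √d =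
      η * (3 * σ ^ 2) + η * (2 * R ^ 2) + η * (K * R ^ 2) := by rw [hη]; ring
  have hηR : η * ‖θ₀‖ ^ 2 ≤ η * R ^ 2 := by gcongr
  have hηR2 : η ^ 2 * ‖θ₀‖ ^ 2 ≤ η * (K * R ^ 2) := by
    rw [sq, mul_assoc]
    gcongr
  have hησ : 0 ≤ η * σ ^ 2 := by positivity
  have hηK2 : 0 ≤ η * (K * R ^ 2) := by positivity
  have hηR0 : 0 ≤ η * R ^ 2 := by positivity
  rw [hC, abs_le]
  constructor
  -- For `3η ≤ 1` the coefficient `1 - 3η` of `‖θ - θ₀‖²` is nonnegative after absorption. Otherwise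
  -- `3ησ² > σ²`, and nonnegativity of the risk suffices.
  · rcases le_or_gt (3 * η) 1 with h | h
    · have hnorm : ‖θ‖ ^ 2 ≤ 2 * ‖θ - θ₀‖ ^ 2 + 2 * ‖θ₀‖ ^ 2 := by
        have h1 : ‖θ‖ ≤ ‖θ - θ₀‖ + ‖θ₀‖ := by simpa using norm_add_le (θ - θ₀) θ₀
        have h2 : ‖θ‖ ^ 2 ≤ (‖θ - θ₀‖ + ‖θ₀‖) ^ 2 := by gcongr
        linarith [sq_nonneg (‖θ - θ₀‖ - ‖θ₀‖)]
      have h3 := mul_le_mul_of_nonneg_left hnorm hη0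
      have h4 : 0 ≤ (1 - 3 * η) * ‖θ - θ₀‖ ^ 2 := mul_nonneg (by linarith) (sq_nonneg _)
      linarith
    · have h3 : 0 ≤ (3 * η - 1) * σ ^ 2 := mul_nonneg (by linarith) (sq_nonneg _)
      linarith
  · linarith

end Risk

/-! ### The main theorem. -/

theorem mainTheorem3 (σ ε R : ℝ) (hσ : 0 < σ) (hε : 0 < ε) :
    -- all the risks involved are finite, and `θ₀` has the least nominal risk, equal to `σ²`
    (∀ (d : ℕ), 0 < d → ∀ θ₀ θ : Euc d,
      Integrable (fun p => sqLoss (linHyp θ p.1) p.2) (linRegLaw θ₀ σ) ∧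
      (∀ ρ ∈ Set.Icc (0 : ℝ) 1,
        Integrable (probRobustLoss (ballUniform d ε) ρ (linHyp θ)) (linRegLaw θ₀ σ)) ∧
      nominalRisk (linRegLaw θ₀ σ) (linHyp θ₀) = σ ^ 2 ∧
      nominalRisk (linRegLaw θ₀ σ) (linHyp θ₀) ≤ nominalRisk (linRegLaw θ₀ σ) (linHyp θ)) ∧
    -- `ρ > 0`: the gap is `O(1/√d)`
    (∀ ρ ∈ Set.Ioc (0 : ℝ) 1, ∃ C : ℝ, ∀ (d : ℕ), 0 < d →
      ∀ (θ₀ : Euc d) (Θ : Set (Euc d)) (θs : Euc d), ‖θ₀‖ ≤ R → θ₀ ∈ Θ →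
        IsProbRobustOptimal θ₀ σ ε ρ Θ θs →
        |probRobustRisk (linRegLaw θ₀ σ) (ballUniform d ε) ρ (linHyp θs) -
          nominalRisk (linRegLaw θ₀ σ) (linHyp θ₀)| ≤ C / Real.sqrt d) ∧
    -- `ρ = 0`: the gap is bounded
    (∃ C : ℝ, ∀ (d : ℕ), 0 < d →
      ∀ (θ₀ : Euc d) (Θ : Set (Euc d)) (θs : Euc d), ‖θ₀‖ ≤ R → θ₀ ∈ Θ →
        IsProbRobustOptimal θ₀ σ ε 0 Θ θs →
        |probRobustRisk (linRegLaw θ₀ σ) (ballUniform d ε) 0 (linHyp θs) -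
          nominalRisk (linRegLaw θ₀ σ) (linHyp θ₀)| ≤ C) ∧
    -- `ρ = 0`: the gap does not vanish
    (∀ r : ℝ, 0 < r → ∃ c : ℝ, 0 < c ∧ ∀ (d : ℕ), 0 < d →
      ∀ (θ₀ : Euc d) (Θ : Set (Euc d)) (θs : Euc d), r ≤ ‖θ₀‖ → θ₀ ∈ Θ →
        IsProbRobustOptimal θ₀ σ ε 0 Θ θs →
        c ≤ probRobustRisk (linRegLaw θ₀ σ) (ballUniform d ε) 0 (linHyp θs) -
          nominalRisk (linRegLaw θ₀ σ) (linHyp θ₀)) := by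
  -- At `ρ = 1` the entry `2ε/√(1 - ρ)` of the maximum is 0, by the convention for division by zero.
  refine ⟨fun d _ θ₀ θ => ⟨integrable_residual_sq θ₀ θ σ, fun ρ hρ => ?_, ?_, ?_⟩,
    fun ρ hρ => ⟨max (ε / √ρ) (2 * ε / √(1 - ρ)) * (3 * σ ^ 2 + 2 * R ^ 2 +
      max (ε / √ρ) (2 * ε / √(1 - ρ)) * R ^ 2), fun d hd θ₀ Θ θs hR hmem hopt => ?_⟩,
    ⟨σ ^ 2 + 2 * ε ^ 2 * R ^ 2, fun d _ θ₀ Θ θs hR hmem hopt => ?_⟩,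
    fun r hr => ⟨min 1 (ε ^ 2) * (r ^ 2 / 2), by positivity,
      fun d _ θ₀ Θ θs hr' _ _ => ?_⟩⟩
  · rw [show probRobustLoss (ballUniform d ε) ρ (linHyp θ) = _ from
      funext (probRobustLoss_linHyp θ)]
    exact integrable_ballLoss hε hρ.2 θ₀ θ σ
  · simp [nominalRisk_linHyp]
  · simp [nominalRisk_linHyp]
  · rw [nominalRisk_linHyp, sub_self, norm_zero, zero_pow two_ne_zero, zero_add]
    exact abs_probRobustRisk_sub_le hd hε hρ.1 hρ.2 (le_max_left _ _) (le_max_right _ _)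
      hR hmem hopt
  · rw [nominalRisk_linHyp, sub_self, norm_zero, zero_pow two_ne_zero, zero_add]
    have hlow := le_probRobustRisk_zero hε θ₀ θs σ
    have hup : probRobustRisk (linRegLaw θ₀ σ) (ballUniform d ε) 0 (linHyp θ₀) ≤
        2 * (‖θ₀ - θ₀‖ ^ 2 + σ ^ 2) + 2 * ε ^ 2 * ‖θ₀‖ ^ 2 :=
      probRobustRisk_le hε zero_le_one θ₀ θ₀ σ fun g => by
        have h1 := ballLoss_le hε zero_le_one θ₀ g
        have h2 := sq_nonneg (|g| - ε * ‖θ₀‖)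
        have h3 := sq_abs g
        linarith
    have hle : probRobustRisk (linRegLaw θ₀ σ) (ballUniform d ε) 0 (linHyp θs) ≤
      probRobustRisk (linRegLaw θ₀ σ) (ballUniform d ε) 0 (linHyp θ₀) := hopt.2 hmem
    rw [sub_self, norm_zero] at hup
    have hR2 : 2 * ε ^ 2 * ‖θ₀‖ ^ 2 ≤ 2 * ε ^ 2 * R ^ 2 := by gcongr
    have h1 : 0 ≤ ε ^ 2 * ‖θs‖ ^ 2 := by positivity
    rw [abs_of_nonneg (by linarith [sq_nonneg ‖θs - θ₀‖])]
    linarith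
  · rw [nominalRisk_linHyp, sub_self, norm_zero, zero_pow two_ne_zero, zero_add]
    have hlow := le_probRobustRisk_zero hε θ₀ θs σ
    -- From `r ≤ ‖θs - θ₀‖ + ‖θs‖` and `(a + b)² ≤ 2a² + 2b²`.
    have hr2 : r ^ 2 / 2 ≤ ‖θs - θ₀‖ ^ 2 + ‖θs‖ ^ 2 := by
      have h1 : ‖θ₀‖ ≤ ‖θs - θ₀‖ + ‖θs‖ := by
        rw [norm_sub_rev]; simpa using norm_add_le (θ₀ - θs) θs
      have h2 : r ^ 2 ≤ (‖θs - θ₀‖ + ‖θs‖) ^ 2 := by gcongr; linarith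
      linarith [sq_nonneg (‖θs - θ₀‖ - ‖θs‖)]
    have h3 : min 1 (ε ^ 2) * (r ^ 2 / 2) ≤
        min 1 (ε ^ 2) * ‖θs - θ₀‖ ^ 2 + min 1 (ε ^ 2) * ‖θs‖ ^ 2 := by
      rw [← mul_add]; gcongr
    have h4 : min 1 (ε ^ 2) * ‖θs - θ₀‖ ^ 2 ≤ 1 * ‖θs - θ₀‖ ^ 2 := by
      gcongr; exact min_le_left _ _
    have h5 : min 1 (ε ^ 2) * ‖θs‖ ^ 2 ≤ ε ^ 2 * ‖θs‖ ^ 2 := by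
      gcongr; exact min_le_right _ _
    linarith
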